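/- Let $D$ be an (unoriented) link diagram in the plane, i.e. a finite collection of closed curves in $\mathbb R^2$ (possibly disconnected, possibly with components without crossings, possibly empty) whose only singularities are finitely many transverse double points with over/under information. Let $\mathcal X(D)$ be its set of crossings. A state is a subset $S\subset\mathcal X(D)$. Label the four strand ends at a crossing $0,1,2,3$ counterclockwise so that $0,2$ lie on the under-strand. The smoothing $D_S$ is the disjoint union of circles obtained by replacing each crossing $c$ by two disjoint arcs, joining the ends $0$–$1$ and $2$–$3$ if $c\notin S$, and $0$–$3$ and $1$–$2$ if $c\in S$. Let $\pi_0(D_S)$ be its set of circles. For $c\notin S$, if only one circle $C$ of $D_S$ is adjacent to $c$, then $c$ splits $C$ into two circles of $D_{S\cup\{c\}}$; if two circles $C_1,C_2$ of $D_S$ are adjacent to $c$, then $c$ merges them into one circle of $D_{S\cup\{c\}}$; every circle of $D_S$ not adjacent to $c$ is identified with the corresponding circle of $D_{S\cup\{c\}}$. A twisting weight on $D$ is a map $\nu:\coprod_{S\subset\mathcal X(D)}\pi_0(D_S)\to\mathbb Z$ such that, for every state $S$ and every crossing $c\notin S$: (a) if $c$ splits $C\in\pi_0(D_S)$ into $C'_1,C'_2\in\pi_0(D_{S\cup\{c\}})$,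 then $\nu(C)=\nu(C'_1)+\nu(C'_2)-1$; (b) if $c$ merges $C_1,C_2\in\pi_0(D_S)$ into $C'\in\pi_0(D_{S\cup\{c\}})$, then $\nu(C_1)+\nu(C_2)=\nu(C')$; (c) if $C\in\pi_0(D_S)$ is not adjacent to $c$ and is identified with $C'\in\pi_0(D_{S\cup\{c\}})$, then $\nu(C)=\nu(C')$. Theorem. Every link diagram $D$ admits a twisting weight. -/

import Mathlib

/-- An (unoriented) link diagram in the plane, given by its planar diagram code: a plane `4`-valent
graph (loops and multiple edges allowed, not necessarily connected or nonempty) with crossing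
information, together with finitely many simple closed curves without crossings.

The four ends of strands at a crossing `c` are `(c, 0), (c, 1), (c, 2), (c, 3)` in counterclockwise
order, where `(c, 0)` and `(c, 2)` are the two ends of the under-strand, and `(c, 1)` and `(c, 3)`
are the two ends of the over-strand. The involution `edge` takes each end to the other end of the
edge of the diagram to which it belongs. Planarity is Euler's formula. -/
structure LinkDiagram where
  /-- the set of crossings -/
  Crossing : Type
  /-- the set of components without crossings -/
  FreeCircle : Type
  finite_crossing : Finite Crossing
  finite_freeCircle : Finite FreeCircle
  /-- the other end of the same edge -/
  edge : Crossing × ZMod 4 → Crossing × ZMod 4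
  edge_edge : ∀ d, edge (edge d) = d
  edge_ne : ∀ d, edge d ≠ d
  /-- `V - E + F = 2 K`, where `V`, `E`, `F` and `K` are the numbers of vertices, of edges, of
  boundary walks of faces (traverse an edge, then turn to the next end around the crossing reached)
  and of connected components of the `4`-valent graph. Each component has `V - E + F ≤ 2`, with
  equality if and only if it is drawn on a sphere, so the formula says that every component is
  plane. -/
  euler : (Nat.card Crossing : ℤ)
      - Nat.card (Quot fun d d' : Crossing × ZMod 4 => d' = edge d)
      + Nat.card (Quot fun d d' : Crossing × ZMod 4 => d' = ((edge d).1, (edge d).2 + 1))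
    = 2 * Nat.card (Quot fun c c' : Crossing => ∃ i j, edge (c, i) = (c', j))

namespace LinkDiagram

/-- The pieces from which the smoothings are assembled: ends of edges at crossings, and
crossingless components. -/
abbrev Piece (D : LinkDiagram) : Type := (D.Crossing × ZMod 4) ⊕ D.FreeCircle

open Classical in
/-- The smoothing arcs in the state `S`: a crossing `c ∉ S` is replaced by two arcs joining `(c, 0)`
to `(c, 1)` and `(c, 2)` to `(c, 3)`, a crossing `c ∈ S` by two arcs joining `(c, 0)` to `(c, 3)`
and `(c, 1)` to `(c, 2)`. -/
noncomputable def arc (D : LinkDiagram) (S : Set D.Crossing) (d : D.Crossing × ZMod 4) :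
    D.Crossing × ZMod 4 :=
  if d.1 ∈ S then (d.1, 3 - d.2) else (d.1, 1 - d.2)

/-- Two pieces are joined in the smoothing `D_S` by an edge of `D` or by a smoothing arc. -/
inductive Joined (D : LinkDiagram) (S : Set D.Crossing) : D.Piece → D.Piece → Prop
  | edge (d : D.Crossing × ZMod 4) : Joined D S (Sum.inl d) (Sum.inl (D.edge d))
  | arc (d : D.Crossing × ZMod 4) : Joined D S (Sum.inl d) (Sum.inl (D.arc S d))

/-- `π₀(D_S)`, the set of circles of the smoothing `D_S`. -/
def Circle (D : LinkDiagram) (S : Set D.Crossing) : Type := Quot (D.Joined S)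

/-- The circle of `D_S` that contains a given piece. -/
def circleOf (D : LinkDiagram) (S : Set D.Crossing) (p : D.Piece) : D.Circle S :=
  Quot.mk (D.Joined S) p

/-- The set of circles of `D_S` that are adjacent to the crossing `c`. -/
def adjacentCircles (D : LinkDiagram) (S : Set D.Crossing) (c : D.Crossing) : Set (D.Circle S) :=
  Set.range fun i : ZMod 4 => D.circleOf S (Sum.inl (c, i))

/-- The crossing `c` splits the circle `C` of `D_S` into the circles `C₁'` and `C₂'` of
`D_{S ∪ {c}}`. -/
def Splits (D : LinkDiagram) (S : Set D.Crossing) (c : D.Crossing) (C : D.Circle S)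
    (C₁' C₂' : D.Circle (insert c S)) : Prop :=
  D.adjacentCircles S c = {C} ∧ C₁' ≠ C₂' ∧ D.adjacentCircles (insert c S) c = {C₁', C₂'}

/-- The crossing `c` merges the circles `C₁` and `C₂` of `D_S` into the circle `C'` of
`D_{S ∪ {c}}`. -/
def Merges (D : LinkDiagram) (S : Set D.Crossing) (c : D.Crossing) (C₁ C₂ : D.Circle S)
    (C' : D.Circle (insert c S)) : Prop :=
  C₁ ≠ C₂ ∧ D.adjacentCircles S c = {C₁, C₂} ∧ D.adjacentCircles (insert c S) c = {C'}

/-- The circle `C` of `D_S` is apart from the crossing `c`, and `C'` is the same circle regarded as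
a circle of `D_{S ∪ {c}}`. -/
def Identified (D : LinkDiagram) (S : Set D.Crossing) (c : D.Crossing) (C : D.Circle S)
    (C' : D.Circle (insert c S)) : Prop :=
  C ∉ D.adjacentCircles S c ∧ ∀ p : D.Piece, D.circleOf S p = C ↔ D.circleOf (insert c S) p = C'

/-- A twisting weight on `D`: an integer for every circle of every smoothing, subject to the rules
for splitting, merging and untouched circles along every edge `S → S ∪ {c}` of the cube. -/
structure IsTwistingWeight (D : LinkDiagram) (ν : (Σ S : Set D.Crossing, D.Circle S) → ℤ) :
    Prop where
  split : ∀ (S : Set D.Crossing) (c : D.Crossing), c ∉ S →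
    ∀ (C : D.Circle S) (C₁' C₂' : D.Circle (insert c S)), D.Splits S c C C₁' C₂' →
      ν ⟨S, C⟩ = ν ⟨insert c S, C₁'⟩ + ν ⟨insert c S, C₂'⟩ - 1
  merge : ∀ (S : Set D.Crossing) (c : D.Crossing), c ∉ S →
    ∀ (C₁ C₂ : D.Circle S) (C' : D.Circle (insert c S)), D.Merges S c C₁ C₂ C' →
      ν ⟨S, C₁⟩ + ν ⟨S, C₂⟩ = ν ⟨insert c S, C'⟩
  identified : ∀ (S : Set D.Crossing) (c : D.Crossing), c ∉ S →
    ∀ (C : D.Circle S) (C' : D.Circle (insert c S)), D.Identified S c C C' →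
      ν ⟨S, C⟩ = ν ⟨insert c S, C'⟩

end LinkDiagram

/-! Look for an integer `a` on each corner (a crossing and an adjacent quadrant) and put `ν C = (1 +
w C) / 2`, where `w C` sums `a` over the corners crossed by the smoothing arcs of `C`; a
crossingless component has `w = 1`. Adding `c` to the state moves the arcs at `c` from corners 1, 3
to corners 0, 2. If `a₀ + a₂ = a₁ + a₃ + 1` at every crossing, the total `w` of the circles at `c`
grows by one, and this is exactly the split and merge rules. What remains is that every `w C` be
odd.

Modulo two this asks for `x` on corners with sum 1 at every crossing and along every circle of every
state. Corners are the edges of a bipartite graph on crossings and faces; let `δ` be its coboundary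
over `ZMod 2`. If the functional `A ↦ ∑ A` kills `ker δ`, it factors as `x ∘ δ`. The indicator of a
crossing then gives the crossing condition. For a circle `C`, planarity gives `A`, one side of `C`,
whose coboundary indicates the corners of `C` (`exists_coboundary_eq_cornersOf`, a dimension count),
so `∑ A = 1` is needed.

Both facts about `∑ A` follow from signs of permutations. Following circles with `A` on the right is
following faces in `A`, corrected by one transposition per crossing in `A`. So `∑ A` is, mod two,
the number of directed circles with `A` on the right (`sum_eq_card_orbits`). A separating circle
contributes one direction, any other circle contributes none or both. -/

open Equiv

/-! ### Signs and numbers of orbits -/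

theorem Finset.card_image_eq_card_image {α β γ : Type*} [DecidableEq β] [DecidableEq γ]
    (s : Finset α) (f : α → β) (g : α → γ) (h : ∀ a ∈ s, ∀ b ∈ s, f a = f b ↔ g a = g b) :
    (s.image f).card = (s.image g).card := by
  classical
  have h1 := Finset.card_image_of_injOn (s := s.image fun a => (f a, g a)) (f := Prod.fst)
  have h2 := Finset.card_image_of_injOn (s := s.image fun a => (f a, g a)) (f := Prod.snd)
  rw [Finset.image_image] at h1 h2
  refine (h1 ?_).trans (h2 ?_).symm
  all_goals
    intro x hx y hy hxy
    simp only [Finset.coe_image, Set.mem_image, Finset.mem_coe] at hx hy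
    obtain ⟨a, ha, rfl⟩ := hx
    obtain ⟨b, hb, rfl⟩ := hy
    have := h a ha b hb
    simp_all

/-- The sign of a permutation is determined by the parity of the number of its orbits. -/
theorem Equiv.Perm.sign_eq_neg_one_pow_card_orbits {α β : Type*} [Fintype α] [DecidableEq α]
    [Fintype β] (σ : Perm α) (f : α → β) (hf : Function.Surjective f)
    (h : ∀ a b, f a = f b ↔ σ.SameCycle a b) :
    Perm.sign σ = (-1) ^ (Fintype.card α + Fintype.card β) := by
  classical
  have h1 : (σ.support.image f).card = σ.cycleFactorsFinset.card := by
    rw [Finset.card_image_eq_card_image σ.support f σ.cycleOf]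
    · congr 1
      ext c
      simp only [Finset.mem_image]
      constructor
      · rintro ⟨a, ha, rfl⟩
        exact Perm.cycleOf_mem_cycleFactorsFinset_iff.2 ha
      · intro hc
        obtain ⟨a, ha⟩ := (Perm.mem_cycleFactorsFinset_iff.1 hc).1.nonempty_support
        exact ⟨a, Perm.mem_cycleFactorsFinset_support_le hc ha,
          (Perm.cycle_is_cycleOf ha hc).symm⟩
    · intro a ha b _
      rw [h, Perm.sameCycle_iff_cycleOf_eq_of_mem_support ha ‹_›]
  have h2 : (σ.supportᶜ.image f).card = σ.supportᶜ.card := by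
    apply Finset.card_image_of_injOn
    intro a ha b _ hab
    have ha' : Function.IsFixedPt σ a := by simpa [Function.IsFixedPt] using ha
    exact (((h a b).1 hab).eq_of_left ha')
  have h3 : _root_.Disjoint (σ.support.image f) (σ.supportᶜ.image f) := by
    rw [Finset.disjoint_left]
    intro x hx hy
    simp only [Finset.mem_image] at hx hy
    obtain ⟨a, ha, rfl⟩ := hx
    obtain ⟨b, hb, hab⟩ := hy
    exact Finset.mem_compl.1 hb (((h b a).1 hab).mem_support_iff.2 ha)
  have h4 : σ.support.image f ∪ σ.supportᶜ.image f = Finset.univ := by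
    rw [← Finset.image_union, Finset.union_compl, Finset.image_univ_of_surjective hf]
  have h5 := Finset.card_union_of_disjoint h3
  rw [h4, h1, h2, Finset.card_univ] at h5
  have h6 := Finset.card_add_card_compl σ.support
  rw [Perm.sign_of_cycleType, Perm.sum_cycleType, h5, ← h6]
  have : σ.cycleType.card = σ.cycleFactorsFinset.card := by simp [Perm.cycleType]
  rw [this, show σ.support.card + σ.supportᶜ.card + (σ.cycleFactorsFinset.card + σ.supportᶜ.card)
    = σ.support.card + σ.cycleFactorsFinset.card + (σ.supportᶜ.card + σ.supportᶜ.card) by ring,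
    pow_add _ _ (_ + _), Even.neg_one_pow (n := _ + _) ⟨_, rfl⟩, mul_one]

/-! ### Corners, face boundaries and directed circles -/

namespace LinkDiagram

variable (D : LinkDiagram)

/-- The ends of edges at crossings. The end `(c, i)` also stands for the corner at `c` between the
ends `(c, i - 1)` and `(c, i)`, and for its edge, directed away from `c`. -/
abbrev Dart : Type := D.Crossing × ZMod 4

/-- The set of edges. -/
abbrev Edge : Type := Quot fun d d' : D.Dart => d' = D.edge d

/-- The set of boundary walks of faces. -/
abbrev Face : Type := Quot fun d d' : D.Dart => d' = ((D.edge d).1, (D.edge d).2 + 1)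

/-- The set of connected components of the underlying graph. -/
abbrev Component : Type := Quot fun c c' : D.Crossing => ∃ i j, D.edge (c, i) = (c', j)

/-- The face at a corner. -/
abbrev face (d : D.Dart) : D.Face := Quot.mk _ d

/-- Traverse an edge, then turn to the next end around the crossing reached. -/
def facePerm : Perm D.Dart where
  toFun d := ((D.edge d).1, (D.edge d).2 + 1)
  invFun d := D.edge (d.1, d.2 - 1)
  left_inv d := by simp [D.edge_edge]
  right_inv d := by simp [D.edge_edge]

theorem facePerm_apply (d : D.Dart) : D.facePerm d = ((D.edge d).1, (D.edge d).2 + 1) := rfl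

theorem face_facePerm (d : D.Dart) : D.face (D.facePerm d) = D.face d :=
  (Quot.sound (r := fun d d' : D.Dart => d' = ((D.edge d).1, (D.edge d).2 + 1)) rfl).symm

theorem face_eq_iff (d e : D.Dart) : D.face d = D.face e ↔ D.facePerm.SameCycle d e := by
  constructor
  · intro h
    rw [face, face, Quot.eq] at h
    induction h with
    | rel x y h => exact ⟨1, by rw [h]; rfl⟩
    | refl x => exact Perm.SameCycle.refl _ _
    | symm x y _ ih => exact ih.symm
    | trans x y z _ _ h1 h2 => exact h1.trans h2
  · rintro ⟨n, rfl⟩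
    have key : ∀ n : ℤ, D.face ((D.facePerm ^ n) d) = D.face d := by
      intro n
      induction n using Int.induction_on with
      | zero => rfl
      | succ n ih => rw [add_comm, zpow_add, zpow_one, Perm.mul_apply, face_facePerm, ih]
      | pred n ih =>
        rw [← ih, ← D.face_facePerm, ← Perm.mul_apply, ← zpow_one_add]
        congr 3; ring
    exact (key n).symm

variable (S : Set D.Crossing)

/-- The smoothing arc at a given end passes through the corner before that end. -/
def IsArcCorner (d : D.Dart) : Prop := D.arc S d = (d.1, d.2 - 1)

theorem isArcCorner_iff (d : D.Dart) :
    D.IsArcCorner S d ↔ ((d.1 ∈ S ∧ (d.2 = 0 ∨ d.2 = 2)) ∨ (d.1 ∉ S ∧ (d.2 = 1 ∨ d.2 = 3))) := by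
  obtain ⟨c, i⟩ := d
  by_cases h : c ∈ S <;> simp only [IsArcCorner, arc, h] <;> revert i <;>
    simp <;> decide

theorem isArcCorner_add_one (c : D.Crossing) (i : ZMod 4) :
    D.IsArcCorner S (c, i + 1) ↔ ¬ D.IsArcCorner S (c, i) := by
  rw [isArcCorner_iff, isArcCorner_iff]
  by_cases h : c ∈ S <;> simp only [h] <;> revert i <;> simp <;> decide

theorem isArcCorner_sub_one (c : D.Crossing) (i : ZMod 4) :
    D.IsArcCorner S (c, i - 1) ↔ ¬ D.IsArcCorner S (c, i) := by
  have := D.isArcCorner_add_one S c (i - 1)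
  rw [sub_add_cancel] at this
  tauto

theorem arc_of_isArcCorner {d : D.Dart} (h : D.IsArcCorner S d) : D.arc S d = (d.1, d.2 - 1) := h

theorem arc_of_not_isArcCorner {d : D.Dart} (h : ¬ D.IsArcCorner S d) :
    D.arc S d = (d.1, d.2 + 1) := by
  rw [isArcCorner_iff] at h
  obtain ⟨c, i⟩ := d
  revert h
  by_cases h : c ∈ S <;> simp only [arc, h] <;> revert i <;>
    simp <;> decide

theorem arc_arc (d : D.Dart) : D.arc S (D.arc S d) = d := by
  unfold arc
  split_ifs <;> simp_all

theorem arc_ne (d : D.Dart) : D.arc S d ≠ d := by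
  by_cases h : D.IsArcCorner S d
  · rw [D.arc_of_isArcCorner S h]
    simpa [Prod.ext_iff] using (by decide : ¬ (1 : ZMod 4) = 0)
  · rw [D.arc_of_not_isArcCorner S h]
    simpa [Prod.ext_iff] using (by decide : ¬ (1 : ZMod 4) = 0)

/-- Exactly one of the two ends of an arc indexes the corner it crosses, so a sum over arc corners
counts each arc once. -/
theorem isArcCorner_arc (d : D.Dart) : D.IsArcCorner S (D.arc S d) ↔ ¬ D.IsArcCorner S d := by
  by_cases h : D.IsArcCorner S d
  · rw [D.arc_of_isArcCorner S h, isArcCorner_sub_one]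
  · rw [D.arc_of_not_isArcCorner S h, isArcCorner_add_one]

/-- Traverse an edge, then the smoothing arc at its end. -/
noncomputable def circlePerm : Perm D.Dart where
  toFun d := D.arc S (D.edge d)
  invFun d := D.edge (D.arc S d)
  left_inv d := by simp [D.edge_edge, arc_arc]
  right_inv d := by simp [D.edge_edge, arc_arc]

theorem circlePerm_apply (d : D.Dart) : D.circlePerm S d = D.arc S (D.edge d) := rfl

theorem circlePerm_inv_apply (d : D.Dart) : (D.circlePerm S)⁻¹ d = D.edge (D.arc S d) := rfl

/-- `circlePerm` is a product of two involutions, so conjugation by `edge` inverts it, as in a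
dihedral group. -/
theorem edge_circlePerm_zpow (n : ℤ) (d : D.Dart) :
    D.edge ((D.circlePerm S ^ n) d) = (D.circlePerm S ^ (-n)) (D.edge d) := by
  induction n using Int.induction_on generalizing d with
  | zero => rfl
  | succ n ih =>
    rw [zpow_add, Perm.mul_apply, ih, neg_add, zpow_add, Perm.mul_apply, zpow_one, zpow_neg_one,
      circlePerm_apply, circlePerm_inv_apply]
  | pred n ih =>
    rw [sub_eq_add_neg, zpow_add, Perm.mul_apply, ih, neg_add, zpow_add, Perm.mul_apply, neg_neg 1,
      zpow_one, zpow_neg_one, circlePerm_apply, circlePerm_inv_apply, D.edge_edge, D.edge_edge]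

/-- Reversing the direction leads to a different directed circle. -/
theorem not_sameCycle_edge (d : D.Dart) : ¬ (D.circlePerm S).SameCycle d (D.edge d) := by
  rintro ⟨n, hn⟩
  -- A circle equal to its own reverse would have a turning point halfway: an edge if `n` is even,
  -- an arc if `n` is odd. Neither involution has fixed points.
  obtain ⟨m, rfl | rfl⟩ := Int.even_or_odd' n
  · apply D.edge_ne ((D.circlePerm S ^ m) d)
    rw [edge_circlePerm_zpow, ← hn, ← Perm.mul_apply, ← zpow_add]
    congr 2; ring
  · apply D.arc_ne S (D.edge ((D.circlePerm S ^ m) d))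
    rw [← circlePerm_apply, ← Perm.mul_apply, ← zpow_one_add, edge_circlePerm_zpow, ← hn,
      ← Perm.mul_apply, ← zpow_add]
    congr 2; ring

theorem sameCycle_edge_iff (d e : D.Dart) :
    (D.circlePerm S).SameCycle (D.edge d) (D.edge e) ↔ (D.circlePerm S).SameCycle d e := by
  have key : ∀ d e, (D.circlePerm S).SameCycle d e →
      (D.circlePerm S).SameCycle (D.edge d) (D.edge e) := by
    rintro d e ⟨n, rfl⟩
    exact ⟨-n, by rw [edge_circlePerm_zpow]⟩
  exact ⟨fun h => by simpa [D.edge_edge] using key _ _ h, key d e⟩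

theorem circleOf_edge (d : D.Dart) :
    D.circleOf S (Sum.inl (D.edge d)) = D.circleOf S (Sum.inl d) :=
  (Quot.sound (Joined.edge d)).symm

theorem circleOf_arc (d : D.Dart) :
    D.circleOf S (Sum.inl (D.arc S d)) = D.circleOf S (Sum.inl d) :=
  (Quot.sound (Joined.arc d)).symm

/-- Two ends lie on the same circle if and only if the circle can be followed from one to the other,
in one of the two directions. -/
theorem circleOf_eq_iff (d e : D.Dart) :
    D.circleOf S (Sum.inl d) = D.circleOf S (Sum.inl e) ↔
      (D.circlePerm S).SameCycle d e ∨ (D.circlePerm S).SameCycle (D.edge d) e := by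
  constructor
  · intro h
    -- The union of the two directed orbits is closed under edges and arcs, so it descends to the
    -- quotient.
    let P : D.Piece → Prop := fun p => Sum.elim
      (fun e => (D.circlePerm S).SameCycle d e ∨ (D.circlePerm S).SameCycle (D.edge d) e)
      (fun _ => False) p
    have hedge : ∀ e, P (Sum.inl e) → P (Sum.inl (D.edge e)) := by
      rintro e (h | h)
      · exact Or.inr ((D.sameCycle_edge_iff S _ _).2 h)
      · refine Or.inl ?_
        have := (D.sameCycle_edge_iff S _ _).2 h
        rwa [D.edge_edge] at this
    have harc : ∀ e, P (Sum.inl e) → P (Sum.inl (D.arc S e)) := by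
      intro e h
      have := hedge e h
      have e1 : D.arc S e = D.circlePerm S (D.edge e) := by rw [circlePerm_apply, D.edge_edge]
      rw [e1]
      simpa only [P, Sum.elim_inl, Perm.sameCycle_apply_right] using this
    have hP : ∀ p q, D.Joined S p q → P p = P q := by
      intro p q hpq
      cases hpq with
      | edge e => exact propext ⟨hedge e, fun h => by simpa [D.edge_edge] using hedge _ h⟩
      | arc e => exact propext ⟨harc e, fun h => by simpa [D.arc_arc] using harc _ h⟩
    have := congrArg (Quot.lift P hP) h
    have h0 : P (Sum.inl d) := Or.inl (Perm.SameCycle.refl _ _)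
    exact this.mp h0
  · have key : ∀ d e, (D.circlePerm S).SameCycle d e →
        D.circleOf S (Sum.inl d) = D.circleOf S (Sum.inl e) := by
      rintro d e ⟨n, rfl⟩
      induction n using Int.induction_on with
      | zero => rfl
      | succ n ih =>
        rw [add_comm, zpow_add, zpow_one, Perm.mul_apply, circlePerm_apply, circleOf_arc,
          circleOf_edge, ih]
      | pred n ih =>
        rw [sub_eq_add_neg, add_comm, zpow_add, zpow_neg_one, Perm.mul_apply, circlePerm_inv_apply,
          circleOf_edge, circleOf_arc, ih]
    rintro (h | h)
    · exact key _ _ h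
    · rw [← D.circleOf_edge S d, key _ _ h]

end LinkDiagram

/-! ### Sides of circles and their parity -/

namespace LinkDiagram

variable (D : LinkDiagram) (S : Set D.Crossing)

open Classical in
/-- The indicator function of the corners through which circles in `T` pass. -/
noncomputable def cornersOf (T : Set (D.Circle S)) (d : D.Dart) : ZMod 2 :=
  if D.IsArcCorner S d ∧ D.circleOf S (Sum.inl d) ∈ T then 1 else 0

/-- The coboundary of a function on crossings and faces, as a function on corners. -/
def coboundary : (D.Crossing ⊕ D.Face → ZMod 2) →ₗ[ZMod 2] (D.Dart → ZMod 2) :=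
  LinearMap.funLeft _ _ (fun d => Sum.inl d.1) + LinearMap.funLeft _ _ (fun d => Sum.inr (D.face d))

theorem coboundary_apply (A : D.Crossing ⊕ D.Face → ZMod 2) (d : D.Dart) :
    D.coboundary A d = A (Sum.inl d.1) + A (Sum.inr (D.face d)) := rfl

theorem _root_.ZMod.two_eq_zero_or_one (a : ZMod 2) : a = 0 ∨ a = 1 := by
  revert a; decide

variable {D S} {T : Set (D.Circle S)} {A : D.Crossing ⊕ D.Face → ZMod 2}

open Classical in
-- Of the two corners beside an end, exactly one carries the arc through that end. Comparing both
-- faces with the crossing shows that `A` changes across an edge precisely when its circle is in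
-- `T`.
theorem face_edge_of_coboundary (hA : D.coboundary A = D.cornersOf S T) (d : D.Dart) :
    A (Sum.inr (D.face (D.edge d))) =
      A (Sum.inr (D.face d)) + if D.circleOf S (Sum.inl d) ∈ T then 1 else 0 := by
  rw [← D.face_facePerm d, facePerm_apply, ← D.circleOf_edge S d]
  generalize D.edge d = e
  obtain ⟨c, j⟩ := e
  have h1 := congrFun hA (c, j)
  have h2 := congrFun hA (c, j + 1)
  simp only [coboundary_apply, cornersOf, isArcCorner_add_one] at h1 h2
  by_cases h : D.IsArcCorner S (c, j)
  · simp only [h, true_and, not_true, false_and, if_false] at h1 h2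
    rw [← h1]
    linear_combination h2 - A (Sum.inl c) * (by decide : (2 : ZMod 2) = 0)
      - A (Sum.inr (D.face (c, j + 1))) * (by decide : (2 : ZMod 2) = 0)
  · have h3 : D.circleOf S (Sum.inl (c, j + 1)) = D.circleOf S (Sum.inl (c, j)) := by
      rw [← D.circleOf_arc S (c, j), D.arc_of_not_isArcCorner S h]
    simp only [h, true_and, not_false_iff, false_and, if_false, h3] at h1 h2
    rw [← h2]
    linear_combination h1 - A (Sum.inl c) * (by decide : (2 : ZMod 2) = 0)
      - A (Sum.inr (D.face (c, j + 1))) * (by decide : (2 : ZMod 2) = 0)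

theorem eq_of_not_isArcCorner (hA : D.coboundary A = D.cornersOf S T) {d : D.Dart}
    (h : ¬ D.IsArcCorner S d) : A (Sum.inr (D.face d)) = A (Sum.inl d.1) := by
  have h1 := congrFun hA d
  simp only [coboundary_apply, cornersOf, h, false_and, if_false] at h1
  linear_combination h1 - A (Sum.inl d.1) * (by decide : (2 : ZMod 2) = 0)

/-- The side of a circle is preserved along it: the arc either turns with the face, or passes
between two arc-free corners, where `A` agrees with its value at the crossing. -/
theorem face_circlePerm_of_coboundary (hA : D.coboundary A = D.cornersOf S T) (d : D.Dart) :
    A (Sum.inr (D.face (D.circlePerm S d))) = A (Sum.inr (D.face d)) := by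
  rw [← D.face_facePerm d, facePerm_apply, circlePerm_apply]
  generalize D.edge d = e
  by_cases h : D.IsArcCorner S e
  · rw [eq_of_not_isArcCorner hA (by rwa [isArcCorner_arc, not_not]), eq_of_not_isArcCorner hA
      (by rwa [isArcCorner_add_one, not_not]), D.arc_of_isArcCorner S h]
  · rw [D.arc_of_not_isArcCorner S h]

section

variable (A)

/-- The directed edges with a face in `A` on the right. -/
def IsInner (d : D.Dart) : Prop := A (Sum.inr (D.face d)) = 1

/-- `facePerm`, restricted to the faces in `A`. -/
def innerFacePerm : Perm {d : D.Dart // IsInner A d} :=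
  D.facePerm.subtypePerm fun d => by simp only [IsInner, face_facePerm]

/-- `circlePerm`, restricted to the inner sides of circles. -/
noncomputable def innerCirclePerm (hA : D.coboundary A = D.cornersOf S T) :
    Perm {d : D.Dart // IsInner A d} :=
  (D.circlePerm S).subtypePerm fun d => by
    simp only [IsInner, face_circlePerm_of_coboundary hA]

open Classical in
/-- Exchange the two corners without smoothing arcs at every crossing in `A`. -/
noncomputable def crossOver (S : Set D.Crossing) : Perm D.Dart :=
  prodCongrRight fun c =>
    if A (Sum.inl c) = 1 then (if c ∈ S then swap 1 3 else swap 0 2) else 1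

end

theorem sign_crossOver [Fintype D.Crossing] [DecidableEq D.Crossing] :
    Perm.sign (crossOver A S) =
      (-1) ^ Fintype.card {c : D.Crossing // A (Sum.inl c) = 1} := by
  classical
  have h (c : D.Crossing) : Perm.sign (if A (Sum.inl c) = 1 then
      (if c ∈ S then swap 1 3 else swap 0 2) else 1 : Perm (ZMod 4)) =
      if A (Sum.inl c) = 1 then -1 else 1 := by
    split_ifs
    · exact Perm.sign_swap (by decide)
    · exact Perm.sign_swap (by decide)
    · simp
  rw [crossOver, Perm.sign_prodCongrRight]
  simp only [h]
  rw [Finset.prod_ite, Finset.prod_const, Finset.prod_const_one, mul_one, Fintype.card_subtype]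

theorem crossOver_apply_of_isArcCorner {d : D.Dart} (h : D.IsArcCorner S d) :
    crossOver A S d = d := by
  rw [isArcCorner_iff] at h
  obtain ⟨c, i⟩ := d
  simp only [crossOver, prodCongrRight_apply, Prod.mk.injEq, true_and]
  rcases h with ⟨h, h'⟩ | ⟨h, h'⟩ <;> simp only at h h' <;> simp only [h, if_true, if_false] <;>
    split_ifs <;> rcases h' with rfl | rfl <;> rfl

theorem crossOver_apply_of_not_isArcCorner {d : D.Dart} (h : ¬ D.IsArcCorner S d)
    (hd : A (Sum.inl d.1) = 1) : crossOver A S d = (d.1, d.2 + 2) := by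
  rw [isArcCorner_iff] at h
  obtain ⟨c, i⟩ := d
  simp only at hd
  simp only [crossOver, prodCongrRight_apply, Prod.mk.injEq, true_and, hd, if_true]
  revert h
  by_cases h : c ∈ S <;> simp only [h] <;> revert i <;> simp <;> decide

theorem crossOver_apply_of_ne_one {d : D.Dart} (hd : A (Sum.inl d.1) ≠ 1) :
    crossOver A S d = d := by
  obtain ⟨c, i⟩ := d
  simp only at hd
  simp [crossOver, prodCongrRight_apply, hd]

theorem isInner_crossOver (hA : D.coboundary A = D.cornersOf S T) (d : D.Dart) :
    IsInner A (crossOver A S d) ↔ IsInner A d := by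
  by_cases h : D.IsArcCorner S d
  · rw [crossOver_apply_of_isArcCorner h]
  · by_cases hd : A (Sum.inl d.1) = 1
    · rw [crossOver_apply_of_not_isArcCorner h hd, IsInner, IsInner, eq_of_not_isArcCorner hA h,
        eq_of_not_isArcCorner hA]
      rw [show d.2 + 2 = d.2 + 1 + 1 by ring, isArcCorner_add_one, isArcCorner_add_one, not_not]
      exact h
    · rw [crossOver_apply_of_ne_one hd]

/-- An arc turns as the face boundary does, or to the opposite arc-free corner. In the latter case
the crossing is in `A`, and `crossOver` makes the correction. -/
theorem innerCirclePerm_eq (hA : D.coboundary A = D.cornersOf S T) :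
    innerCirclePerm A hA =
      ((crossOver A S).subtypePerm fun d => isInner_crossOver hA d) * innerFacePerm A := by
  ext1 ⟨d, hd⟩
  apply Subtype.ext
  change D.arc S (D.edge d) = crossOver A S ((D.edge d).1, (D.edge d).2 + 1)
  rw [IsInner, ← face_facePerm, facePerm_apply] at hd
  generalize D.edge d = e at *
  by_cases h : D.IsArcCorner S e
  · have h' : ¬ D.IsArcCorner S (e.1, e.2 + 1) := by rwa [isArcCorner_add_one, not_not]
    rw [D.arc_of_isArcCorner S h, crossOver_apply_of_not_isArcCorner h'
      (by rwa [← eq_of_not_isArcCorner hA h'])]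
    simp only [Prod.mk.injEq, true_and]
    generalize e.2 = i
    revert i; decide
  · rw [D.arc_of_not_isArcCorner S h, crossOver_apply_of_isArcCorner
      ((D.isArcCorner_add_one S _ _).2 h)]

open Classical in
/-- Modulo two, the number of crossings and faces in `A` is the number of directed boundary circles
of `A`. -/
theorem sum_eq_card_orbits [Fintype D.Crossing] [Fintype D.Face]
    (hA : D.coboundary A = D.cornersOf S T) :
    ∑ n, A n = (Nat.card (Quotient (Perm.SameCycle.setoid (innerCirclePerm A hA))) : ZMod 2) := by
  have : Fintype (Quotient (Perm.SameCycle.setoid (innerCirclePerm A hA))) := Fintype.ofFinite _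
  have h1 := Perm.sign_eq_neg_one_pow_card_orbits (innerCirclePerm A hA)
    (Quotient.mk (Perm.SameCycle.setoid (innerCirclePerm A hA))) Quotient.mk_surjective
    (fun a b => Quotient.eq)
  have h2 := Perm.sign_eq_neg_one_pow_card_orbits (innerFacePerm A)
    (β := {f : D.Face // A (Sum.inr f) = 1})
    (fun d => ⟨D.face d.1, d.2⟩)
    (by
      rintro ⟨f, hf⟩
      induction f using Quot.ind with | mk d => exact ⟨⟨d, hf⟩, rfl⟩)
    (fun a b => by
      exact Subtype.mk_eq_mk.trans ((D.face_eq_iff _ _).trans Perm.sameCycle_subtypePerm.symm))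
  have h3 : Perm.sign ((crossOver A S).subtypePerm fun d => isInner_crossOver hA d) =
      (-1) ^ Fintype.card {c : D.Crossing // A (Sum.inl c) = 1} := by
    rw [Perm.sign_subtypePerm, sign_crossOver]
    intro d hd
    by_cases h : D.IsArcCorner S d
    · exact absurd (crossOver_apply_of_isArcCorner h) hd
    · by_contra h'
      rw [IsInner, eq_of_not_isArcCorner hA h] at h'
      exact hd (crossOver_apply_of_ne_one h')
  -- The number of inner darts enters the signs of both permutations and cancels.
  have h0 := congrArg Perm.sign (innerCirclePerm_eq hA)
  rw [Perm.sign_mul, h2, h3, h1, ← pow_add] at h0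
  have h4 : ∀ m n : ℕ, ((-1 : ℤˣ)) ^ m = (-1) ^ n → (m : ZMod 2) = n := by
    intro m n h
    rcases Nat.even_or_odd m with hm | hm <;> rcases Nat.even_or_odd n with hn | hn
    · rw [(ZMod.natCast_eq_zero_iff_even).2 hm, (ZMod.natCast_eq_zero_iff_even).2 hn]
    · rw [hm.neg_one_pow, hn.neg_one_pow] at h
      exact absurd h (by decide)
    · rw [hm.neg_one_pow, hn.neg_one_pow] at h
      exact absurd h (by decide)
    · rw [(ZMod.natCast_eq_one_iff_odd).2 hm, (ZMod.natCast_eq_one_iff_odd).2 hn]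
  have h5 := h4 _ _ h0
  have h6 : ∀ {ι : Type} [Fintype ι] (f : ι → ZMod 2),
      ∑ i, f i = (Fintype.card {i // f i = 1} : ZMod 2) := by
    intro ι _ f
    rw [Fintype.card_subtype, Finset.card_filter]
    push_cast
    refine Finset.sum_congr rfl fun i _ => ?_
    rcases ZMod.two_eq_zero_or_one (f i) with h | h <;> simp [h]
  rw [Fintype.sum_sum_type, h6, h6, Nat.card_eq_fintype_card]
  push_cast at h5
  linear_combination -h5

/-- The circle to which a directed boundary circle of `A` belongs. -/
noncomputable def circleOfOrbit (hA : D.coboundary A = D.cornersOf S T) :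
    Quotient (Perm.SameCycle.setoid (innerCirclePerm A hA)) → D.Circle S :=
  Quotient.lift (fun d => D.circleOf S (Sum.inl d.1)) fun _ _ h =>
    (D.circleOf_eq_iff S _ _).2 (Or.inl (Perm.sameCycle_subtypePerm.1 h))

theorem isInner_edge (hA : D.coboundary A = D.cornersOf S T) {d : D.Dart}
    (hd : D.circleOf S (Sum.inl d) ∉ T) : IsInner A (D.edge d) ↔ IsInner A d := by
  rw [IsInner, IsInner, face_edge_of_coboundary hA, if_neg hd, add_zero]

open Classical in
theorem reverse_respects (hA : D.coboundary A = D.cornersOf S T)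
  (d e : {d : D.Dart // IsInner A d}) (h : (innerCirclePerm A hA).SameCycle d e) :
  (innerCirclePerm A hA).SameCycle
    (if h : D.circleOf S (Sum.inl d.1) ∈ T then d else ⟨D.edge d.1, (isInner_edge hA h).2 d.2⟩)
    (if h : D.circleOf S (Sum.inl e.1) ∈ T then e else ⟨D.edge e.1, (isInner_edge hA h).2 e.2⟩) := by
  have h' := (Perm.sameCycle_subtypePerm.1 h)
  have h0 := (D.circleOf_eq_iff S _ _).2 (Or.inl h')
  by_cases hT : D.circleOf S (Sum.inl d.1) ∈ T
  · rw [dif_pos hT, dif_pos (h0 ▸ hT)]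
    exact h
  · rw [dif_neg hT, dif_neg (h0 ▸ hT)]
    exact Perm.sameCycle_subtypePerm.2 ((D.sameCycle_edge_iff S _ _).2 h')

open Classical in
/-- Reverse the direction of directed boundary circles that are not in `T`. -/
noncomputable def reverse (hA : D.coboundary A = D.cornersOf S T) :
    Quotient (Perm.SameCycle.setoid (innerCirclePerm A hA)) →
      Quotient (Perm.SameCycle.setoid (innerCirclePerm A hA)) :=
  Quotient.map _ (reverse_respects hA)

/-- A circle outside `T` has equal values of `A` on both sides, so reversal is a fixed-point-free
involution on its inner orbits. -/
theorem card_orbits_eq [Finite D.Crossing] (hA : D.coboundary A = D.cornersOf S T) :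
    (Nat.card (Quotient (Perm.SameCycle.setoid (innerCirclePerm A hA))) : ZMod 2) =
      (Nat.card {o // circleOfOrbit hA o ∈ T} : ZMod 2) := by
  classical
  have : Fintype (Quotient (Perm.SameCycle.setoid (innerCirclePerm A hA))) := Fintype.ofFinite _
  rw [Nat.card_eq_fintype_card, Nat.card_eq_fintype_card, Fintype.card_subtype, ← Finset.card_univ,
    ← Finset.card_filter_add_card_filter_not (s := Finset.univ) (fun o => circleOfOrbit hA o ∈ T)]
  push_cast
  rw [add_eq_left, Finset.cast_card]
  have hmk (d : {d : D.Dart // IsInner A d}) (h : D.circleOf S (Sum.inl d.1) ∉ T) :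
      reverse hA (Quotient.mk _ d) = Quotient.mk _ ⟨D.edge d.1, (isInner_edge hA h).2 d.2⟩ := by
    rw [reverse, Quotient.map_mk, dif_neg h]
  refine Finset.sum_involution (fun o _ => reverse hA o) (fun _ _ => by decide) ?_ ?_ ?_
  · intro o ho _
    induction o using Quotient.inductionOn with | _ d => ?_
    rw [Finset.mem_filter] at ho
    rw [hmk d ho.2]
    intro h
    exact D.not_sameCycle_edge S d.1 (Perm.sameCycle_subtypePerm.1 (Quotient.exact h)).symm
  · intro o ho
    induction o using Quotient.inductionOn with | _ d => ?_
    rw [Finset.mem_filter] at ho ⊢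
    rw [hmk d ho.2]
    refine ⟨Finset.mem_univ _, ?_⟩
    change D.circleOf S (Sum.inl (D.edge d.1)) ∉ T
    rw [circleOf_edge]
    exact ho.2
  · intro o ho
    induction o using Quotient.inductionOn with | _ d => ?_
    rw [Finset.mem_filter] at ho
    simp only [hmk d ho.2]
    rw [hmk ⟨D.edge d.1, _⟩ (by rw [circleOf_edge]; exact ho.2)]
    simp only [D.edge_edge]

theorem sum_eq_zero_of_coboundary_eq_zero [Fintype D.Crossing] [Fintype D.Face]
    (hA : D.coboundary A = 0) : ∑ n, A n = 0 := by
  have hA' : D.coboundary A = D.cornersOf ∅ ∅ := by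
    rw [hA]; ext d; simp [cornersOf]
  rw [sum_eq_card_orbits hA', card_orbits_eq]
  simp

/-- The two sides of this circle have different values of `A`, so exactly one of its directions is
inner. -/
theorem sum_eq_one_of_coboundary_eq [Fintype D.Crossing] [Fintype D.Face] (d : D.Dart)
    (hA : D.coboundary A = D.cornersOf S {D.circleOf S (Sum.inl d)}) : ∑ n, A n = 1 := by
  rw [sum_eq_card_orbits hA, card_orbits_eq]
  suffices Nat.card {o // circleOfOrbit hA o ∈ ({D.circleOf S (Sum.inl d)} : Set _)} = 1 by
    rw [this, Nat.cast_one]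
  have hedge (e : D.Dart) (he : D.circleOf S (Sum.inl e) = D.circleOf S (Sum.inl d)) :
      IsInner A (D.edge e) ↔ ¬ IsInner A e := by
    rw [IsInner, IsInner, face_edge_of_coboundary hA, he, if_pos (Set.mem_singleton _)]
    generalize A (Sum.inr (D.face e)) = a
    revert a; decide
  rw [Nat.card_eq_one_iff_unique]
  constructor
  · constructor
    rintro ⟨o, ho⟩ ⟨o', ho'⟩
    induction o using Quotient.inductionOn with | _ e => ?_
    induction o' using Quotient.inductionOn with | _ e' => ?_
    change D.circleOf S (Sum.inl e.1) = D.circleOf S (Sum.inl d) at ho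
    change D.circleOf S (Sum.inl e'.1) = D.circleOf S (Sum.inl d) at ho'
    apply Subtype.ext
    apply Quotient.sound
    rcases (D.circleOf_eq_iff S _ _).1 (ho.trans ho'.symm) with h | ⟨n, hn⟩
    · exact Perm.sameCycle_subtypePerm.2 h
    · exfalso
      have key : ∀ n : ℤ, ∀ x, IsInner A ((D.circlePerm S ^ n) x) ↔ IsInner A x := by
        have h1 : ∀ x, IsInner A (D.circlePerm S x) ↔ IsInner A x := fun x => by
          rw [IsInner, IsInner, face_circlePerm_of_coboundary hA]
        intro n
        induction n using Int.induction_on with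
        | zero => exact fun x => Iff.rfl
        | succ n ih => exact fun x => by rw [zpow_add, Perm.mul_apply, ih, zpow_one, h1]
        | pred n ih =>
          exact fun x => by
            rw [zpow_sub, Perm.mul_apply, ih, zpow_one, ← h1, ← Perm.mul_apply, mul_inv_cancel,
              Perm.one_apply]
      have := e'.2
      rw [← hn, key, hedge e.1 ho] at this
      exact this e.2
  · by_cases h : IsInner A d
    · exact ⟨⟨Quotient.mk _ ⟨d, h⟩, rfl⟩⟩
    · exact ⟨⟨Quotient.mk _ ⟨D.edge d, (hedge d rfl).2 h⟩, D.circleOf_edge S d⟩⟩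

end LinkDiagram

/-! ### Planarity, separation and corner weights modulo two -/

namespace LinkDiagram

variable (D : LinkDiagram) (S : Set D.Crossing)

instance : Finite D.Crossing := D.finite_crossing

instance : Finite D.FreeCircle := D.finite_freeCircle

/-- The sum of a function on edges around the edges at a corner; the transpose of the map that
sums a function on corners over the four corners at an edge. -/
def cornerSum : (D.Edge → ZMod 2) →ₗ[ZMod 2] (D.Dart → ZMod 2) :=
  LinearMap.funLeft _ _ (fun d => Quot.mk _ d) +
    LinearMap.funLeft _ _ (fun d => Quot.mk _ (d.1, d.2 - 1))

theorem cornerSum_apply (g : D.Edge → ZMod 2) (d : D.Dart) :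
    D.cornerSum g d = g (Quot.mk _ d) + g (Quot.mk _ (d.1, d.2 - 1)) := rfl

theorem mk_edge (d : D.Dart) : (Quot.mk _ (D.edge d) : D.Edge) = Quot.mk _ d :=
  (Quot.sound (r := fun d d' : D.Dart => d' = D.edge d) rfl).symm

theorem eq_of_add_eq_zero {a b : ZMod 2} (h : a + b = 0) : a = b := by
  revert a b; decide

/-- A cocycle agrees at a crossing and its faces, hence is constant on components. -/
theorem finrank_ker_coboundary_le :
    Module.finrank (ZMod 2) (LinearMap.ker D.coboundary) ≤ Nat.card D.Component := by
  have := Fintype.ofFinite D.Component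
  let p : D.Crossing ⊕ D.Face → D.Component := Sum.elim (Quot.mk _)
    (Quot.lift (fun d => Quot.mk _ d.1) fun d d' h =>
      Quot.sound ⟨d.2, (D.edge d).2, by rw [h]⟩)
  have h : LinearMap.ker D.coboundary ≤ LinearMap.range (LinearMap.funLeft (ZMod 2) (ZMod 2) p) := by
    intro A hA
    have hA (d : D.Dart) : A (Sum.inl d.1) = A (Sum.inr (D.face d)) :=
      eq_of_add_eq_zero (congrFun (LinearMap.mem_ker.1 hA) d)
    refine ⟨Quot.lift (fun c => A (Sum.inl c)) ?_, ?_⟩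
    · rintro c c' ⟨i, j, h⟩
      have h1 := hA (c, i)
      have h2 := hA (D.facePerm (c, i))
      rw [face_facePerm, ← h1, facePerm_apply, h] at h2
      exact h2.symm
    · ext n
      rcases n with c | f
      · rfl
      · induction f using Quot.ind with | mk d => exact hA d
  refine (Submodule.finrank_mono h).trans ((LinearMap.finrank_range_le _).trans ?_)
  rw [Module.finrank_pi, Nat.card_eq_fintype_card]

theorem finrank_ker_cornerSum_le :
    Module.finrank (ZMod 2) (LinearMap.ker D.cornerSum) ≤ Nat.card D.Component := by
  have := Fintype.ofFinite D.Component
  let p : D.Edge → D.Component := Quot.lift (fun d => Quot.mk _ d.1) fun d d' h =>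
      Quot.sound ⟨d.2, (D.edge d).2, by rw [h]⟩
  have h : LinearMap.ker D.cornerSum ≤ LinearMap.range (LinearMap.funLeft (ZMod 2) (ZMod 2) p) := by
    intro g hg
    have hg (d : D.Dart) : g (Quot.mk _ d) = g (Quot.mk _ (d.1, d.2 - 1)) :=
      eq_of_add_eq_zero (congrFun (LinearMap.mem_ker.1 hg) d)
    have hg' (c : D.Crossing) : ∀ i, g (Quot.mk _ (c, i)) = g (Quot.mk _ (c, 0)) := by
      have h1 := hg (c, 1)
      have h2 := hg (c, 2)
      have h3 := hg (c, 3)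
      have e1 : (1 : ZMod 4) - 1 = 0 := by decide
      have e2 : (2 : ZMod 4) - 1 = 1 := by decide
      have e3 : (3 : ZMod 4) - 1 = 2 := by decide
      simp only [e1, e2, e3] at h1 h2 h3
      intro i
      fin_cases i
      · rfl
      · exact h1
      · exact h2.trans h1
      · exact h3.trans (h2.trans h1)
    refine ⟨Quot.lift (fun c => g (Quot.mk _ (c, 0))) ?_, ?_⟩
    · rintro c c' ⟨i, j, h⟩
      rw [← hg' c i, ← hg' c' j, ← h, mk_edge]
    · ext e
      induction e using Quot.ind with | mk d => exact (hg' d.1 d.2).symm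
  refine (Submodule.finrank_mono h).trans ((LinearMap.finrank_range_le _).trans ?_)
  rw [Module.finrank_pi, Nat.card_eq_fintype_card]

theorem two_mul_card_crossing_le : 2 * Nat.card D.Crossing ≤ Nat.card D.Edge := by
  classical
  have := Fintype.ofFinite D.Crossing
  have := Fintype.ofFinite D.Edge
  have h := Finset.card_le_mul_card_image (s := (Finset.univ : Finset D.Dart))
    (f := fun d => (Quot.mk _ d : D.Edge)) 2 (by
      intro e _
      induction e using Quot.ind with | mk d => ?_
      refine (Finset.card_le_card (t := {d, D.edge d}) ?_).trans Finset.card_le_two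
      intro d' hd'
      have hd' : (Quot.mk _ d' : D.Edge) = Quot.mk _ d := (Finset.mem_filter.1 hd').2
      have hP : ∀ x y, y = D.edge x → (x = d ∨ x = D.edge d) = (y = d ∨ y = D.edge d) := by
        rintro x y rfl
        apply propext
        constructor
        · rintro (rfl | rfl)
          · exact Or.inr rfl
          · exact Or.inl (D.edge_edge d)
        · rintro (h | h)
          · exact Or.inr (by rw [← h, D.edge_edge])
          · exact Or.inl (by rw [← D.edge_edge x, h, D.edge_edge])
      have h1 : (d' = d ∨ d' = D.edge d) = (d = d ∨ d = D.edge d) :=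
        congrArg (Quot.lift (fun x => x = d ∨ x = D.edge d) hP) hd'
      have h2 : d' = d ∨ d' = D.edge d := h1.mpr (Or.inl rfl)
      simpa using h2)
  have h' : _ ≤ Fintype.card D.Edge :=
    Finset.card_le_univ (Finset.univ.image (fun d : D.Dart => (Quot.mk _ d : D.Edge)))
  rw [Finset.card_univ, Fintype.card_prod, ZMod.card] at h
  rw [Nat.card_eq_fintype_card, Nat.card_eq_fintype_card]
  omega

/-- Rotation about a crossing, and `facePerm` along a face, carry one of the two edges at a corner
to the other, so the terms cancel mod two. -/
theorem sum_coboundary_mul_cornerSum [Fintype D.Crossing] (A : D.Crossing ⊕ D.Face → ZMod 2)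
    (g : D.Edge → ZMod 2) : ∑ d, D.coboundary A d * D.cornerSum g d = 0 := by
  have h1 : ∑ d : D.Dart, A (Sum.inl d.1) * g (Quot.mk _ (d.1, d.2 - 1)) =
      ∑ d : D.Dart, A (Sum.inl d.1) * g (Quot.mk _ d) :=
    Fintype.sum_equiv (prodCongrRight fun _ => Equiv.subRight 1) _ _ fun d => rfl
  have h2 : ∑ d : D.Dart, A (Sum.inr (D.face d)) * g (Quot.mk _ d) =
      ∑ d : D.Dart, A (Sum.inr (D.face d)) * g (Quot.mk _ (d.1, d.2 - 1)) :=
    Fintype.sum_equiv D.facePerm _ _ fun d => by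
      rw [face_facePerm, facePerm_apply]
      simp only [add_sub_cancel_right]
      rw [← mk_edge]
  simp only [coboundary_apply, cornerSum_apply, add_mul, mul_add, Finset.sum_add_distrib, h1, h2,
    CharTwo.add_self_eq_zero]

/-- Regrouped by ends, the sum counts every edge on a circle of `T` twice. -/
theorem sum_cornersOf_mul_cornerSum [Fintype D.Crossing] (T : Set (D.Circle S))
    (g : D.Edge → ZMod 2) : ∑ d, D.cornersOf S T d * D.cornerSum g d = 0 := by
  classical
  let t (d : D.Dart) : ZMod 2 := if D.circleOf S (Sum.inl d) ∈ T then g (Quot.mk _ d) else 0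
  have ht : ∑ d, t d = 0 := by
    refine Finset.sum_involution (fun d _ => D.edge d) ?_ ?_ (fun _ _ => Finset.mem_univ _)
      (fun d _ => D.edge_edge d)
    · intro d _
      simp only [t, circleOf_edge, mk_edge]
      exact CharTwo.add_self_eq_zero _
    · exact fun d _ _ => D.edge_ne d
  have h1 : ∑ d : D.Dart, (if D.IsArcCorner S d then t (D.arc S d) else 0) =
      ∑ d : D.Dart, (if D.IsArcCorner S d then 0 else t d) :=
    Fintype.sum_equiv (Function.Involutive.toPerm (D.arc S) (D.arc_arc S)) _ _ fun d => by
      change _ = if D.IsArcCorner S (D.arc S d) then 0 else t (D.arc S d)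
      simp only [isArcCorner_arc, ite_not]
  rw [← ht]
  trans ∑ d : D.Dart, ((if D.IsArcCorner S d then t d else 0) +
      (if D.IsArcCorner S d then t (D.arc S d) else 0))
  · refine Finset.sum_congr rfl fun d _ => ?_
    rw [cornersOf, cornerSum_apply]
    by_cases h : D.IsArcCorner S d
    · simp only [h, true_and, if_true, t, circleOf_arc]
      rw [D.arc_of_isArcCorner S h]
      split_ifs <;> simp
    · simp [h]
  · rw [Finset.sum_add_distrib, h1, ← Finset.sum_add_distrib]
    refine Finset.sum_congr rfl fun d _ => ?_
    split_ifs <;> simp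

/-- In a plane diagram, every union of circles of a smoothing separates. -/
theorem exists_coboundary_eq_cornersOf (T : Set (D.Circle S)) :
    ∃ A, D.coboundary A = D.cornersOf S T := by
  classical
  have := Fintype.ofFinite D.Crossing
  have := Fintype.ofFinite D.Edge
  have := Fintype.ofFinite D.Face
  let W := (LinearMap.range D.cornerSum).dualAnnihilator
  let U := (LinearMap.range D.coboundary).map
    (dotProductEquiv (ZMod 2) D.Dart).toLinearMap
  have hW (v : D.Dart → ZMod 2) (hv : ∀ g, ∑ d, v d * D.cornerSum g d = 0) :
      dotProductEquiv (ZMod 2) D.Dart v ∈ W := by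
    rw [Submodule.mem_dualAnnihilator]
    rintro _ ⟨g, rfl⟩
    exact hv g
  have hUW : U ≤ W := by
    rintro _ ⟨_, ⟨A, rfl⟩, rfl⟩
    exact hW _ (D.sum_coboundary_mul_cornerSum A)
  have hU : Module.finrank (ZMod 2) U = Module.finrank (ZMod 2) (LinearMap.range D.coboundary) :=
    LinearEquiv.finrank_map_eq _ _
  have h1 := LinearMap.finrank_range_add_finrank_ker D.coboundary
  have h2 := LinearMap.finrank_range_add_finrank_ker D.cornerSum
  have h3 := Subspace.finrank_add_finrank_dualAnnihilator_eq (LinearMap.range D.cornerSum)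
  have h4 := D.finrank_ker_coboundary_le
  have h5 := D.finrank_ker_cornerSum_le
  have h6 := D.two_mul_card_crossing_le
  have h7 : (Nat.card D.Crossing : ℤ) - Nat.card D.Edge + Nat.card D.Face =
    2 * Nat.card D.Component := D.euler
  rw [Module.finrank_pi, Fintype.card_sum, ← Nat.card_eq_fintype_card,
    ← Nat.card_eq_fintype_card] at h1
  rw [Module.finrank_pi, ← Nat.card_eq_fintype_card] at h2
  rw [Module.finrank_pi, Fintype.card_prod, ZMod.card, ← Nat.card_eq_fintype_card] at h3
  have hUW' : U = W := by
    apply Submodule.eq_of_le_of_finrank_le hUW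
    rw [hU]
    change Module.finrank (ZMod 2) (LinearMap.range D.cornerSum).dualAnnihilator ≤ _
    -- By Euler's formula, `rank δ ≥ V + F - K = E + K`, while `dim W ≤ 4V - E + K ≤ E + K` as `2V ≤
    -- E`.
    omega
  have h8 := hW _ (D.sum_cornersOf_mul_cornerSum S T)
  rw [← hUW'] at h8
  obtain ⟨_, ⟨A, rfl⟩, h9⟩ := h8
  exact ⟨A, (dotProductEquiv (ZMod 2) D.Dart).injective h9⟩

/-- There is a function on corners modulo two whose sum over the corners through which a circle of
a smoothing passes is always `1`, and whose sum over the corners at a crossing is always `1`. -/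
theorem exists_cornerWeight [Fintype D.Crossing] : ∃ x : D.Dart → ZMod 2,
    (∀ S d, ∑ e, D.cornersOf S {D.circleOf S (Sum.inl d)} e * x e = 1) ∧
    ∀ c, ∑ i, x (c, i) = 1 := by
  classical
  have := Fintype.ofFinite D.Face
  let total : Module.Dual (ZMod 2) (D.Crossing ⊕ D.Face → ZMod 2) := ∑ n, LinearMap.proj n
  have htotal (A) : total A = ∑ n, A n := by simp [total]
  -- A functional vanishing on the kernel factors through the map.
  have h : total ∈ LinearMap.range D.coboundary.dualMap := by
    rw [LinearMap.range_dualMap_eq_dualAnnihilator_ker, Submodule.mem_dualAnnihilator]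
    intro A hA
    rw [htotal, sum_eq_zero_of_coboundary_eq_zero (LinearMap.mem_ker.1 hA)]
  obtain ⟨ξ, hξ⟩ := h
  have hξ (A) : ξ (D.coboundary A) = ∑ n, A n := by rw [← htotal, ← hξ]; rfl
  have hx (v : D.Dart → ZMod 2) : ∑ e, v e * ξ (Pi.single e 1) = ξ v := by
    conv_rhs => rw [pi_eq_sum_univ' v, map_sum]
    refine Finset.sum_congr rfl fun e _ => ?_
    rw [map_smul, smul_eq_mul]
  refine ⟨fun e => ξ (Pi.single e 1), fun S d => ?_, fun c => ?_⟩
  · obtain ⟨A, hA⟩ := D.exists_coboundary_eq_cornersOf S {D.circleOf S (Sum.inl d)}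
    rw [hx, ← hA, hξ, sum_eq_one_of_coboundary_eq d hA]
  · have h := hξ (Pi.single (Sum.inl c) 1)
    rw [← hx, Fintype.sum_prod_type, Finset.sum_eq_single c] at h
    · simpa [coboundary_apply] using h
    · intro c' _ hc'
      simp [coboundary_apply, hc']
    · simp

end LinkDiagram

/-! ### Integral corner weights and weights of circles -/

namespace LinkDiagram

variable (D : LinkDiagram) (S : Set D.Crossing)

theorem exists_int_cornerWeight : ∃ a : D.Dart → ℤ,
    (∀ S d, (∑ᶠ e, D.cornersOf S {D.circleOf S (Sum.inl d)} e * (a e : ZMod 2)) = 1) ∧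
    ∀ c, a (c, 0) + a (c, 2) = a (c, 1) + a (c, 3) + 1 := by
  classical
  have := Fintype.ofFinite D.Crossing
  obtain ⟨x, hx, hx'⟩ := D.exists_cornerWeight
  let b (d : D.Dart) : ℤ := (x d).val
  have hb (d : D.Dart) : (b d : ZMod 2) = x d := by simp [b]
  -- The value at corner 2 is forced by the integral equation; the mod two condition at the crossing
  -- gives it the right parity.
  let a (d : D.Dart) : ℤ := if d.2 = 2 then b (d.1, 1) + b (d.1, 3) + 1 - b (d.1, 0) else b d
  have ha (d : D.Dart) : (a d : ZMod 2) = x d := by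
    obtain ⟨c, i⟩ := d
    simp only [a]
    split_ifs with h
    · push_cast
      simp only [hb, h]
      have h2 : x (c, 0) + x (c, 1) + x (c, 2) + x (c, 3) = 1 := by
        rw [← hx' c]; exact (Fin.sum_univ_four (fun i : Fin 4 => x (c, i))).symm
      rw [← h2]
      linear_combination (x (c, 1) + x (c, 3)) * (by decide : (2 : ZMod 2) = 0)
    · exact hb _
  refine ⟨a, fun S d => ?_, fun c => ?_⟩
  · rw [finsum_eq_sum_of_fintype]
    simp only [ha, hx]
  · simp only [a, if_true, if_neg (by decide : ¬ (0 : ZMod 4) = 2),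
      if_neg (by decide : ¬ (1 : ZMod 4) = 2), if_neg (by decide : ¬ (3 : ZMod 4) = 2)]
    ring

variable {D} (a : D.Dart → ℤ)

open Classical in
/-- The contribution of a piece to the weight of its circle. -/
noncomputable def pieceWeight : D.Piece → ℤ :=
  Sum.elim (fun d => if D.IsArcCorner S d then a d else 0) fun _ => 1

open Classical in
/-- The sum of the contributions of the pieces in a set. -/
noncomputable def weight (U : Set D.Piece) : ℤ :=
  ∑ᶠ p, if p ∈ U then pieceWeight S a p else 0

/-- The pieces of a circle. -/
def pieces {S : Set D.Crossing} (C : D.Circle S) : Set D.Piece := {p | D.circleOf S p = C}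

theorem weight_union {U V : Set D.Piece} (h : Disjoint U V) :
    weight S a (U ∪ V) = weight S a U + weight S a V := by
  classical
  rw [weight, weight, weight, ← finsum_add_distrib (Set.toFinite _) (Set.toFinite _)]
  refine finsum_congr fun p => ?_
  have : p ∈ U → p ∉ V := fun h1 h2 => Set.disjoint_left.1 h h1 h2
  by_cases h1 : p ∈ U <;> by_cases h2 : p ∈ V <;> simp_all

theorem weight_pieces_union {S : Set D.Crossing} {C C' : D.Circle S} (h : C ≠ C') :
    weight S a (pieces C ∪ pieces C') = weight S a (pieces C) + weight S a (pieces C') := by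
  apply weight_union
  rw [Set.disjoint_left]
  rintro p rfl h'
  exact h h'

theorem pieceWeight_insert {S : Set D.Crossing} {c : D.Crossing} {d : D.Dart} (h : d.1 ≠ c) :
    pieceWeight (insert c S) a (Sum.inl d) = pieceWeight S a (Sum.inl d) := by
  have : D.IsArcCorner (insert c S) d ↔ D.IsArcCorner S d := by
    simp only [isArcCorner_iff, Set.mem_insert_iff, h, false_or]
  simp only [pieceWeight, Sum.elim_inl]
  split_ifs <;> tauto

/-- Only the corners at `c` change: 1 and 3 are replaced by 0 and 2. -/
theorem weight_insert {S : Set D.Crossing} {c : D.Crossing} (hc : c ∉ S)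
    (ha : a (c, 0) + a (c, 2) = a (c, 1) + a (c, 3) + 1) {U : Set D.Piece}
    (hU : ∀ i, Sum.inl (c, i) ∈ U) : weight (insert c S) a U = weight S a U + 1 := by
  classical
  have := Fintype.ofFinite D.Crossing
  have := Fintype.ofFinite D.FreeCircle
  rw [← sub_eq_iff_eq_add', weight, weight, finsum_eq_sum_of_fintype, finsum_eq_sum_of_fintype,
    ← Finset.sum_sub_distrib, Fintype.sum_sum_type, Fintype.sum_prod_type,
    Finset.sum_eq_single c, Finset.sum_eq_zero (s := (Finset.univ : Finset D.FreeCircle)), add_zero]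
  · have h (i : ZMod 4) : D.IsArcCorner (insert c S) (c, i) ↔ i = 0 ∨ i = 2 := by
      simp [isArcCorner_iff]
    have h' (i : ZMod 4) : D.IsArcCorner S (c, i) ↔ i = 1 ∨ i = 3 := by
      simp [isArcCorner_iff, hc]
    simp only [hU, if_true, pieceWeight, Sum.elim_inl, h, h']
    have e : ∀ f : ZMod 4 → ℤ, ∑ i, f i = f 0 + f 1 + f 2 + f 3 := fun f => Fin.sum_univ_four f
    rw [e]
    simp +decide only [if_true, if_false]
    linear_combination ha
  · intro z _
    simp [pieceWeight]
  · intro c' _ h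
    refine Finset.sum_eq_zero fun i _ => ?_
    rw [pieceWeight_insert a (d := (c', i)) h, sub_self]
  · simp

/-- The pieces of the circles adjacent to a crossing remain the same when the smoothing of that
crossing is changed. -/
theorem circleOf_mem_adjacentCircles_of {S S' : Set D.Crossing} {c : D.Crossing}
    (h : ∀ c', c' ≠ c → (c' ∈ S ↔ c' ∈ S')) {p : D.Piece}
    (hp : D.circleOf S p ∈ D.adjacentCircles S c) :
    D.circleOf S' p ∈ D.adjacentCircles S' c := by
  have harc (d : D.Dart) (hd : d.1 ≠ c) : D.arc S d = D.arc S' d := by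
    have := h _ hd
    unfold arc
    split_ifs <;> tauto
  have hP : ∀ p q, D.Joined S p q → (D.circleOf S' p ∈ D.adjacentCircles S' c) =
      (D.circleOf S' q ∈ D.adjacentCircles S' c) := by
    intro p q hpq
    cases hpq with
    | edge d => rw [circleOf_edge]
    | arc d =>
      by_cases hd : d.1 = c
      · have h1 (e : D.Dart) (he : e.1 = c) :
            D.circleOf S' (Sum.inl e) ∈ D.adjacentCircles S' c := ⟨e.2, by rw [← he]⟩
        exact propext ⟨fun _ => h1 _ (by unfold arc; split_ifs <;> exact hd), fun _ => h1 _ hd⟩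
      · rw [harc d hd, circleOf_arc]
  obtain ⟨i, hi⟩ := hp
  have h1 := congrArg (Quot.lift _ hP) hi
  exact h1.mp ⟨i, rfl⟩

theorem circleOf_mem_adjacentCircles_insert (c : D.Crossing) (p : D.Piece) :
    D.circleOf (insert c S) p ∈ D.adjacentCircles (insert c S) c ↔
      D.circleOf S p ∈ D.adjacentCircles S c := by
  constructor <;> apply circleOf_mem_adjacentCircles_of <;> intro c' h <;> simp [h]

theorem pieces_circleOf_inr (z : D.FreeCircle) :
    pieces (D.circleOf S (Sum.inr z)) = {Sum.inr z} := by
  ext p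
  constructor
  · intro h
    have hP : ∀ p q, D.Joined S p q → (p = Sum.inr z) = (q = Sum.inr z) := by
      intro p q hpq
      cases hpq <;> simp
    have h1 : (p = Sum.inr z) = (Sum.inr z = Sum.inr z) := congrArg (Quot.lift _ hP) h
    exact h1.mpr rfl
  · rintro rfl
    rfl

theorem odd_weight (ha : ∀ S d,
    (∑ᶠ e, D.cornersOf S {D.circleOf S (Sum.inl d)} e * (a e : ZMod 2)) = 1)
    {S : Set D.Crossing} (C : D.Circle S) : Odd (weight S a (pieces C)) := by
  classical
  have := Fintype.ofFinite D.Crossing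
  have := Fintype.ofFinite D.FreeCircle
  induction C using Quot.ind with | mk p => ?_
  change Odd (weight S a (pieces (D.circleOf S p)))
  rcases p with d | z
  · rw [← ZMod.intCast_eq_one_iff_odd, ← ha S d, weight, finsum_eq_sum_of_fintype,
      finsum_eq_sum_of_fintype, Fintype.sum_sum_type, Int.cast_add,
      Finset.sum_eq_zero (s := (Finset.univ : Finset D.FreeCircle)), Int.cast_zero, add_zero,
      Int.cast_sum]
    · refine Finset.sum_congr rfl fun e _ => ?_
      simp only [pieces, Set.mem_ofPred_eq, pieceWeight, Sum.elim_inl, cornersOf,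
        Set.mem_singleton_iff]
      split_ifs <;> simp_all
    · intro z _
      rw [if_neg]
      intro h
      have : Sum.inl d ∈ pieces (D.circleOf S (Sum.inr z)) := h.symm
      rw [pieces_circleOf_inr] at this
      simp at this
  · rw [weight, pieces_circleOf_inr, finsum_eq_single _ (Sum.inr z) (by simp +contextual)]
    simp [pieceWeight]

end LinkDiagram

/-! ### The twisting weight -/

open LinkDiagram in
theorem mainTheorem1 (D : LinkDiagram) :
    ∃ ν : (Σ S : Set D.Crossing, D.Circle S) → ℤ, D.IsTwistingWeight ν := by
  obtain ⟨a, ha, ha'⟩ := D.exists_int_cornerWeight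
  have hodd {S : Set D.Crossing} (C : D.Circle S) := odd_weight a ha C
  -- The weights are odd, so this integer division is exact.
  refine ⟨fun x => (1 + weight x.1 a (pieces x.2)) / 2, ?_, ?_, ?_⟩
  · rintro S c hc C C₁ C₂ ⟨h1, hne, h2⟩
    have hU : pieces C₁ ∪ pieces C₂ = pieces C := by
      ext p
      have := circleOf_mem_adjacentCircles_insert S c p
      rwa [h1, h2] at this
    have h3 := weight_insert a hc (ha' c) (U := pieces C) fun i => by
      have : D.circleOf S (Sum.inl (c, i)) ∈ D.adjacentCircles S c := ⟨i, rfl⟩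
      rwa [h1] at this
    rw [← hU, weight_pieces_union a hne, hU] at h3
    obtain ⟨k, hk⟩ := hodd C
    obtain ⟨k₁, hk₁⟩ := hodd C₁
    obtain ⟨k₂, hk₂⟩ := hodd C₂
    dsimp only
    omega
  · rintro S c hc C₁ C₂ C ⟨hne, h1, h2⟩
    have hU : pieces C₁ ∪ pieces C₂ = pieces C := by
      ext p
      have := (circleOf_mem_adjacentCircles_insert S c p).symm
      rwa [h1, h2] at this
    have h3 := weight_insert a hc (ha' c) (U := pieces C) fun i => by
      have : D.circleOf (insert c S) (Sum.inl (c, i)) ∈ D.adjacentCircles (insert c S) c := ⟨i, rfl⟩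
      rwa [h2] at this
    nth_rw 2 [← hU] at h3
    rw [weight_pieces_union a hne] at h3
    obtain ⟨k, hk⟩ := hodd C
    obtain ⟨k₁, hk₁⟩ := hodd C₁
    obtain ⟨k₂, hk₂⟩ := hodd C₂
    dsimp only
    omega
  · rintro S c hc C C' ⟨hC, h⟩
    have hU : pieces C' = pieces C := by
      ext p
      exact (h p).symm
    suffices weight (insert c S) a (pieces C) = weight S a (pieces C) by
      dsimp only
      rw [hU, this]
    refine finsum_congr fun p => ?_
    by_cases hp : p ∈ pieces C
    · rw [if_pos hp, if_pos hp]
      rcases p with d | z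
      · apply pieceWeight_insert
        rintro rfl
        exact hC ⟨d.2, hp⟩
      · rfl
    · rw [if_neg hp, if_neg hp]
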